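/- All graphs are finite and simple and $\log$ is the logarithm to base $2$. For integers $t\ge 2$ and $n\ge 0$ let $Q(t,n)$ be the minimum independence number of a $K_t$-free graph on $n$ vertices, and for real $x\ge 0$ put $Q(t,x)=Q(t,\lfloor x\rfloor)$. For a graph $H$ let $RT(n,H,m)$ be the maximum number of edges of an $H$-free graph on $n$ vertices with independence number less than $m$ (and $0$ if there is no such graph), and for a function $g$ let $RT^*(H,g(n))=\limsup_{n\to\infty} RT(n,H,g(n))/n^2$. Theorem. Let $p,q,t\ge 2$ be integers, let $\omega(n)$ be any real-valued function with $\omega(n)\to\infty$ as $n\to\infty$, and let $f(n)=n\,2^{-\omega(n)\,(\log n)^{1-1/q}}$. Suppose that $2t\le pq$ and that $Q\left(t,\frac{n}{\omega(n)}\right)\le Q(p,f(n))$ for all sufficiently large $n$. Then $$RT^*\left(K_{2t},\,Q\left(t,\tfrac{n}{\omega(n)}\right)\right)\le \frac12\left(1-\frac1t\right)\left(1-\frac1{q-1}\right).$$ -/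

import Mathlib

open Filter

/-- `ramseyQ t n` is the minimum independence number of a `K_t`-free graph on `n` vertices
(such graphs exist whenever `2 ≤ t`). -/
noncomputable def ramseyQ (t n : ℕ) : ℕ :=
  sInf {a : ℕ | ∃ G : SimpleGraph (Fin n), G.CliqueFree t ∧ G.indepNum = a}

/-- The Ramsey-Turán number `RT(n, H, m)`: the maximum number of edges of an `H`-free graph on
`n` vertices whose independence number is less than `m` (and `0` if there is no such graph). -/
noncomputable def ramseyTuran {W : Type*} (n : ℕ) (H : SimpleGraph W) (m : ℝ) : ℕ :=
  sSup {e : ℕ | ∃ G : SimpleGraph (Fin n),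
    H.Free G ∧ (G.indepNum : ℝ) < m ∧ G.edgeSet.ncard = e}

/-- The upper Ramsey-Turán density of `H` with respect to `f`: the limit superior, as `n → ∞`, of
`RT(n, H, f n) / n ^ 2`. The sequence takes values in `[0, 1/2]`, so this is a genuine real
limit superior. -/
noncomputable def upperRamseyTuranDensity {W : Type*} (H : SimpleGraph W) (f : ℕ → ℝ) : ℝ :=
  limsup (fun n : ℕ => (ramseyTuran n H (f n) : ℝ) / (n : ℝ) ^ 2) atTop

/-!
Let `G` be a `K_{2t}`-free graph on `n` vertices with independence number below `Q(t, n / ω n)`,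
hence below `Q(p, f n)`. By the definition of `Q`, every set of `n / ω n` vertices contains a `K_t`
and every set of `f n` vertices contains a `K_p`.

* If `G` had a positive proportion of all `K_q`s, then `q` rounds of dependent random choice, each
  passing to a set whose small subsets have at least `f n` common neighbours, would produce `q`
  completely joined copies of `K_p`. But `K_{pq} ⊇ K_{2t}`, so `G` has `o(n ^ q)` copies of `K_q`,
  and the reduced graph of a regular partition is `K_q`-free by the counting lemma. By Turán's
  theorem it has density at most `1 - 1 / (q - 1)`.
* No pair `(A, B)` of linear-sized vertex sets has density above `1 - 1 / t + ε`: otherwise the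
  vertices of `A` with many neighbours in `B` contain a `K_t`, its common neighbourhood in `B` is
  still linear and contains another `K_t`, and the two form a `K_{2t}`.

Hence `e(G) ≤ (1 / 2) (1 - 1 / t) (1 - 1 / (q - 1)) n ^ 2 + o(n ^ 2)`.
-/

namespace RamseyTuran

open Finset

variable {V : Type*} {G : SimpleGraph V}

/-- `CliqueIndepNumLT G p m` says that the `K_p`-independence number of `G`, the largest size of a
set of vertices spanning no `K_p`, is less than `m`. For `p = 2` it bounds the independence
number. The bound `m` is real so that it need not be rounded. -/
def CliqueIndepNumLT (G : SimpleGraph V) (p : ℕ) (m : ℝ) : Prop :=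
  ∀ A : Finset V, G.CliqueFreeOn A p → (#A : ℝ) < m

theorem CliqueIndepNumLT.mono {p : ℕ} {m m' : ℝ} (h : CliqueIndepNumLT G p m) (hm : m ≤ m') :
    CliqueIndepNumLT G p m' :=
  fun A hA ↦ (h A hA).trans_le hm

theorem CliqueIndepNumLT.exists_isNClique {p : ℕ} {m : ℝ} (h : CliqueIndepNumLT G p m)
    {A : Finset V} (hA : m ≤ #A) : ∃ K ⊆ A, G.IsNClique p K := by
  by_contra! hfree
  exact (h A fun K hKA ↦ hfree K (mod_cast hKA)).not_ge hA

theorem indepNum_le_of_embedding {W : Type*} [Finite V] [Finite W] {H : SimpleGraph W}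
    (f : H ↪g G) : H.indepNum ≤ G.indepNum := by
  obtain ⟨s, hs⟩ := H.exists_isNIndepSet_indepNum
  have hmap : G.IsIndepSet (s.map f.toEmbedding : Finset V) := by
    rw [coe_map]
    rintro _ ⟨u, hu, rfl⟩ _ ⟨v, hv, rfl⟩ huv
    simpa using hs.isIndepSet hu hv (ne_of_apply_ne _ huv)
  simpa [hs.card_eq] using hmap.card_le_indepNum

theorem ramseyQ_le_indepNum_of_cliqueFreeOn [Finite V] {t m : ℕ} {A : Finset V}
    (hA : G.CliqueFreeOn A t) (hm : m ≤ #A) : ramseyQ t m ≤ G.indepNum := by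
  obtain ⟨e⟩ : Nonempty (Fin m ↪ (A : Set V)) :=
    Function.Embedding.nonempty_of_card_le (by simpa using hm)
  let f : (G.induce A).comap e ↪g G.induce A := .comap e _
  have hfree : ((G.induce A).comap e).CliqueFree t :=
    ((G.cliqueFree_induce_iff _ _).2 hA).comap ⟨f.toCopy⟩
  calc ramseyQ t m ≤ ((G.induce A).comap e).indepNum := Nat.sInf_le ⟨_, hfree, rfl⟩
    _ ≤ G.indepNum := indepNum_le_of_embedding (f.trans (SimpleGraph.Embedding.induce _))

theorem cliqueIndepNumLT_of_indepNum_lt_ramseyQ [Finite V] {t : ℕ} {m : ℝ}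
    (h : G.indepNum < ramseyQ t ⌊m⌋₊) : CliqueIndepNumLT G t m := by
  intro A hA
  by_contra! hm
  exact (ramseyQ_le_indepNum_of_cliqueFreeOn hA (Nat.floor_le_of_le hm)).not_gt h

theorem isNClique_union [DecidableEq V] {a b : ℕ} {K L : Finset V} (hK : G.IsNClique a K)
    (hL : G.IsNClique b L) (hKL : ∀ u ∈ K, ∀ v ∈ L, G.Adj u v) : G.IsNClique (a + b) (K ∪ L) := by
  have hdisj : Disjoint K L :=
    Finset.disjoint_left.2 fun v hvK hvL ↦ (hKL v hvK v hvL).ne rfl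
  refine ⟨?_, by rw [card_union_of_disjoint hdisj, hK.card_eq, hL.card_eq]⟩
  have := G.symm
  rw [coe_union, SimpleGraph.IsClique, Set.pairwise_union_of_symm]
  exact ⟨hK.isClique, hL.isClique, fun u hu v hv _ ↦ hKL u hu v hv⟩

/-- The ordered cliques `(x 0, …, x (k - 1))` of `G` with `x i ∈ A i`. A constant family `A` gives
the ordered `k`-cliques inside one set, a family of disjoint sets the transversal cliques. -/
def cliqueTuples [Fintype V] [DecidableEq V] (G : SimpleGraph V) [DecidableRel G.Adj] {k : ℕ}
    (A : Fin k → Finset V) : Finset (Fin k → V) :=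
  {x | (∀ i, x i ∈ A i) ∧ ∀ i j, i ≠ j → G.Adj (x i) (x j)}

section cliqueTuples

variable [Fintype V] [DecidableEq V] [DecidableRel G.Adj] {k : ℕ}

theorem mem_cliqueTuples {A : Fin k → Finset V} {x : Fin k → V} :
    x ∈ cliqueTuples G A ↔ (∀ i, x i ∈ A i) ∧ ∀ i j, i ≠ j → G.Adj (x i) (x j) := by
  simp [cliqueTuples]

theorem cliqueTuples_mono {A B : Fin k → Finset V} (h : ∀ i, A i ⊆ B i) :
    cliqueTuples G A ⊆ cliqueTuples G B :=
  fun _ hx ↦ mem_cliqueTuples.2 ((mem_cliqueTuples.1 hx).imp_left fun hA i ↦ h i (hA i))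

theorem cons_mem_cliqueTuples {A : Fin (k + 1) → Finset V} {v : V} {x : Fin k → V} :
    (Fin.cons v x : Fin (k + 1) → V) ∈ cliqueTuples G A ↔
      v ∈ A 0 ∧ x ∈ cliqueTuples G fun i ↦ {w ∈ A i.succ | G.Adj v w} := by
  simp only [mem_cliqueTuples, mem_filter, Fin.forall_fin_succ, Fin.cons_zero,
    Fin.cons_succ, ne_eq, Fin.succ_inj, Fin.succ_ne_zero, (Fin.succ_ne_zero _).symm,
    not_true_eq_false, not_false_eq_true, false_imp_iff, true_imp_iff, true_and, forall_and,
    G.adj_comm _ v]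
  tauto

theorem card_filter_cons_mem (H : Finset (Fin (k + 1) → V)) :
    #{vx : V × (Fin k → V) | (Fin.cons vx.1 vx.2 : Fin (k + 1) → V) ∈ H} = #H :=
  card_equiv (Fin.consEquiv fun _ ↦ V) (by simp [Fin.consEquiv])

end cliqueTuples

section DependentRandomChoice

variable [Fintype V]

theorem sum_card_filter_forall_eq_sum_pow {X : Type*} (r : V → X → Prop)
    [∀ v x, Decidable (r v x)] (B : Finset X) (s : ℕ) :
    ∑ T : Fin s → V, #{x ∈ B | ∀ j, r (T j) x} = ∑ x ∈ B, #{v | r v x} ^ s := by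
  classical
  refine (sum_card_bipartiteAbove_eq_sum_card_bipartiteBelow
    (fun (T : Fin s → V) x ↦ ∀ j, r (T j) x)).trans (sum_congr rfl fun x _ ↦ ?_)
  have hpi : bipartiteBelow (fun (T : Fin s → V) x ↦ ∀ j, r (T j) x) univ x =
      Fintype.piFinset fun _ ↦ {v | r v x} := by
    ext T
    simp [bipartiteBelow]
  rw [hpi, Fintype.card_piFinset_const]

theorem card_mul_pow_le_sum_card_pow {X : Type*} [Fintype X] (r : V → X → Prop)
    [∀ v x, Decidable (r v x)] (s : ℕ) {a : ℝ} (ha : 0 ≤ a)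
    (hr : a * Fintype.card X ≤ #{vx : V × X | r vx.1 vx.2}) :
    Fintype.card X * a ^ s ≤ ∑ x, (#{v | r v x} : ℝ) ^ s := by
  rcases isEmpty_or_nonempty X with hX | hX
  · simp
  have hsum : (#{vx : V × X | r vx.1 vx.2} : ℝ) = ∑ x, (#{v | r v x} : ℝ) := by
    simp only [card_filter, Fintype.sum_prod_type_right, Nat.cast_sum]
  cases s with
  | zero => simp
  | succ n =>
    have hpm := pow_sum_div_card_le_sum_pow (s := univ) (f := fun x ↦ (#{v | r v x} : ℝ))
      (fun _ _ ↦ by positivity) n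
    calc Fintype.card X * a ^ (n + 1)
        = (a * Fintype.card X) ^ (n + 1) / Fintype.card X ^ n := by
          field_simp
          ring
      _ ≤ (∑ x, (#{v | r v x} : ℝ)) ^ (n + 1) / #(univ : Finset X) ^ n := by
          rw [← hsum, card_univ]
          gcongr
      _ ≤ _ := hpm

theorem exists_tuple_dense_link_of_small_sets [Nonempty V] {X : Type*} [Fintype X] [Nonempty X]
    (r : V → X → Prop) [∀ v x, Decidable (r v x)] (s : ℕ) {δ ρ m : ℝ} (hδ : 0 ≤ δ) (hρ : 0 < ρ)
    (hr : δ * (Fintype.card V * Fintype.card X) ≤ #{vx : V × X | r vx.1 vx.2})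
    {B : Finset (Finset V)} (hm : ∀ C ∈ B, (#C : ℝ) ≤ m)
    (hB : #B * m ^ s ≤ (Fintype.card V : ℝ) ^ s * (δ ^ s - ρ)) :
    ∃ T : Fin s → V, ρ * Fintype.card X ≤ #{x | ∀ j, r (T j) x} ∧ ∀ C ∈ B, ∃ j, T j ∉ C := by
  classical
  have hX : (0 : ℝ) < Fintype.card X := mod_cast Fintype.card_pos
  let link (T : Fin s → V) : ℝ := #{x | ∀ j, r (T j) x}
  let bad (T : Fin s → V) : ℝ := #{C ∈ B | ∀ j, T j ∈ C}
  have hlink : Fintype.card X * (δ * Fintype.card V) ^ s ≤ ∑ T, link T := by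
    simp only [link]
    rw [← Nat.cast_sum, sum_card_filter_forall_eq_sum_pow r univ s]
    push_cast
    exact card_mul_pow_le_sum_card_pow r s (by positivity) (by rwa [mul_assoc])
  have hbad : ∑ T, bad T ≤ #B * m ^ s := by
    simp only [bad]
    rw [← Nat.cast_sum, sum_card_filter_forall_eq_sum_pow (fun v (C : Finset V) ↦ v ∈ C) B s,
      ← nsmul_eq_mul]
    push_cast
    refine sum_le_card_nsmul _ _ _ fun C hC ↦ ?_
    simpa using pow_le_pow_left₀ (by positivity) (hm C hC) s
  -- A tuple for which `link - |X| * bad` is at least its average has `bad < 1`.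
  obtain ⟨T, -, hT⟩ : ∃ T ∈ univ, ρ * Fintype.card X ≤ link T - Fintype.card X * bad T := by
    refine exists_le_of_sum_le univ_nonempty ?_
    rw [sum_const, sum_sub_distrib, ← mul_sum, card_univ, Fintype.card_fun, Fintype.card_fin,
      nsmul_eq_mul, Nat.cast_pow]
    rw [mul_pow] at hlink
    nlinarith [mul_le_mul_of_nonneg_left (hbad.trans hB) hX.le]
  have hlinkX : link T ≤ Fintype.card X := Nat.cast_le.2 (card_le_univ _)
  have hbad_lt : bad T < 1 := by
    by_contra! h
    nlinarith [mul_le_mul_of_nonneg_left h hX.le, mul_pos hρ hX]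
  have hbad_zero : #{C ∈ B | ∀ j, T j ∈ C} = 0 := Nat.cast_lt_one.1 hbad_lt
  refine ⟨T, hT.trans (sub_le_self _ (by positivity)), ?_⟩
  simpa [filter_eq_empty_iff] using hbad_zero

variable [DecidableEq V] [DecidableRel G.Adj] [Nonempty V]

theorem exists_subset_rich_commonNeighbors {a k s : ℕ} (hs : 1 ≤ s) {m δ ρ : ℝ} (hm : 0 ≤ m)
    (hδ : 0 ≤ δ) (hρ : 0 < ρ) {A : Finset V}
    (hA : δ * (Fintype.card V : ℝ) ^ (k + 1) ≤ #(cliqueTuples G fun _ : Fin (k + 1) ↦ A))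
    (hpar : (Fintype.card V : ℝ) ^ a * m ^ s ≤ (Fintype.card V : ℝ) ^ s * (δ ^ s - ρ)) :
    ∃ A' ⊆ A, ρ * (Fintype.card V : ℝ) ^ k ≤ #(cliqueTuples G fun _ : Fin k ↦ A') ∧
      ∀ R ⊆ A', #R = a → m ≤ #{v ∈ A | ∀ u ∈ R, G.Adj u v} := by
  let common (R : Finset V) : Finset V := {v ∈ A | ∀ u ∈ R, G.Adj u v}
  let poor : Finset (Finset V) := {R ∈ powersetCard a univ | (#(common R) : ℝ) < m}
  have hpoor : (#(poor.image common) : ℝ) ≤ (Fintype.card V : ℝ) ^ a := by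
    have : #(poor.image common) ≤ Fintype.card V ^ a := calc
      #(poor.image common) ≤ #poor := card_image_le
      _ ≤ #(powersetCard a (univ : Finset V)) := card_filter_le _ _
      _ ≤ Fintype.card V ^ a := by
        rw [card_powersetCard, card_univ]
        exact Nat.choose_le_pow _ _
    exact_mod_cast this
  obtain ⟨T, hlink, hT⟩ := exists_tuple_dense_link_of_small_sets
    (fun v (x : Fin k → V) ↦ Fin.cons v x ∈ cliqueTuples G fun _ : Fin (k + 1) ↦ A) s (m := m)
    (B := poor.image common) hδ hρ
    (by
      rw [card_filter_cons_mem]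
      simpa [pow_succ'] using hA)
    (forall_mem_image.2 fun R hR ↦ (mem_filter.1 hR).2.le)
    ((mul_le_mul_of_nonneg_right hpoor (by positivity)).trans hpar)
  have hTA (j : Fin s) : T j ∈ A := by
    have hpos : (0 : ℝ) < ρ * Fintype.card (Fin k → V) := by positivity
    obtain ⟨x, hx⟩ := card_pos.1 (Nat.cast_pos.1 (hpos.trans_le hlink))
    exact (cons_mem_cliqueTuples.1 ((mem_filter.1 hx).2 j)).1
  refine ⟨{w ∈ A | ∀ j, G.Adj (T j) w}, filter_subset _ _, ?_, fun R hR hRa ↦ ?_⟩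
  · rw [Fintype.card_fun, Fintype.card_fin, Nat.cast_pow] at hlink
    refine hlink.trans (Nat.cast_le.2 (card_le_card fun x hx ↦ ?_))
    have hx' (j : Fin s) := mem_cliqueTuples.1 (cons_mem_cliqueTuples.1 ((mem_filter.1 hx).2 j)).2
    refine mem_cliqueTuples.2 ⟨fun i ↦ mem_filter.2 ⟨?_, fun j ↦ ?_⟩, (hx' ⟨0, hs⟩).2⟩
    · exact (mem_filter.1 ((hx' ⟨0, hs⟩).1 i)).1
    · exact (mem_filter.1 ((hx' j).1 i)).2
  · by_contra! hlt
    have hRpoor : R ∈ poor := mem_filter.2 ⟨mem_powersetCard.2 ⟨subset_univ R, hRa⟩, hlt⟩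
    obtain ⟨j, hj⟩ := hT _ (mem_image_of_mem common hRpoor)
    exact hj (mem_filter.2 ⟨hTA j, fun u hu ↦ ((mem_filter.1 (hR hu)).2 j).symm⟩)

theorem exists_isNClique_mul_of_card_cliqueTuples {p s : ℕ} (hs : 1 ≤ s) {m : ℝ} (hm : 0 ≤ m)
    (hG : CliqueIndepNumLT G p m) (k : ℕ) {A : Finset V} {δ : ℝ} (hδ : 0 < δ) (hδ' : δ ≤ 1 / 2)
    (hA : δ * (Fintype.card V : ℝ) ^ k ≤ #(cliqueTuples G fun _ : Fin k ↦ A))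
    (hpar : (Fintype.card V : ℝ) ^ (p * k) * m ^ s ≤
      (Fintype.card V : ℝ) ^ s * δ ^ ((2 * s) ^ k)) :
    ∃ K ⊆ A, G.IsNClique (p * k) K := by
  induction k generalizing A δ with
  | zero => exact ⟨∅, empty_subset A, by simp [SimpleGraph.isNClique_iff]⟩
  | succ k ih =>
    have hV : (1 : ℝ) ≤ Fintype.card V := mod_cast Fintype.card_pos
    have hδ1 : δ ≤ 1 := by linarith
    have hδs : δ ^ s ≤ 1 / 2 := (pow_le_of_le_one hδ.le hδ1 (by omega)).trans hδ'
    have hδ2s : δ ^ (2 * s) ≤ δ ^ s - δ ^ (2 * s) := by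
      have : δ ^ (2 * s) = δ ^ s * δ ^ s := by rw [two_mul, pow_add]
      nlinarith [pow_pos hδ s]
    have hpow : δ ^ ((2 * s) ^ (k + 1)) ≤ δ ^ s - δ ^ (2 * s) :=
      (pow_le_pow_of_le_one hδ.le hδ1 (Nat.le_self_pow (by omega) _)).trans hδ2s
    have hparK : (Fintype.card V : ℝ) ^ (p * k) * m ^ s ≤
        (Fintype.card V : ℝ) ^ s * δ ^ ((2 * s) ^ (k + 1)) := by
      refine le_trans ?_ hpar
      gcongr
      omega
    obtain ⟨A', hA'A, hA', hrich⟩ := exists_subset_rich_commonNeighbors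
      (ρ := δ ^ (2 * s)) hs hm hδ.le (by positivity) hA (hparK.trans (by gcongr))
    obtain ⟨K, hKA', hK⟩ := ih (δ := δ ^ (2 * s)) (by positivity)
      ((pow_le_pow_of_le_one hδ.le hδ1 (by omega)).trans hδs) hA'
      (by rwa [← pow_mul, ← pow_succ'])
    obtain ⟨L, hLN, hL⟩ := hG.exists_isNClique (hrich K hKA' hK.card_eq)
    refine ⟨K ∪ L, union_subset (hKA'.trans hA'A) (hLN.trans (filter_subset _ _)), ?_⟩
    rw [mul_add_one]
    exact isNClique_union hK hL fun u hu v hv ↦ (mem_filter.1 (hLN hv)).2 u hu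

end DependentRandomChoice

section ChoiceScale

open Real

/-- `choiceScale q W x = x * 2 ^ (-W * (log₂ x) ^ (1 - 1 / q))`. With `x` the number of vertices,
this is the bound on the `K_p`-independence number under which dependent random choice can be
iterated `q` times; the function `f` of the theorem is `f n = choiceScale q (ω n) n`. -/
noncomputable def choiceScale (q : ℕ) (W x : ℝ) : ℝ :=
  x * 2 ^ (-(W * logb 2 x ^ (1 - 1 / (q : ℝ))))

theorem choiceScale_nonneg (q : ℕ) (W : ℝ) {x : ℝ} (hx : 0 ≤ x) : 0 ≤ choiceScale q W x :=
  mul_nonneg hx (by positivity)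

theorem choiceScale_le_choiceScale (q : ℕ) {W W' x : ℝ} (hW : W ≤ W') (hx : 1 ≤ x) :
    choiceScale q W' x ≤ choiceScale q W x := by
  have hlog : 0 ≤ logb 2 x ^ (1 - 1 / (q : ℝ)) := rpow_nonneg (logb_nonneg one_lt_two hx) _
  unfold choiceScale
  gcongr
  exact one_le_two

theorem exists_nat_le_rpow_mul_and_pow_le {q : ℕ} (hq : q ≠ 0) {L : ℝ} (hL : 1 ≤ L) :
    ∃ s : ℕ, 1 ≤ s ∧ L ≤ L ^ (1 - 1 / (q : ℝ)) * s ∧ (s : ℝ) ^ q ≤ 2 ^ q * L := by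
  have hL0 : 0 < L := by linarith
  set R : ℝ := L ^ (1 / (q : ℝ)) with hR
  have hR1 : 1 ≤ R := one_le_rpow hL (by positivity)
  have hRq : R ^ q = L := by rw [hR, one_div, rpow_inv_natCast_pow hL0.le hq]
  have hceil : (⌈R⌉₊ : ℝ) ≤ 2 * R := by linarith [Nat.ceil_lt_add_one (zero_le_one.trans hR1)]
  refine ⟨⌈R⌉₊, Nat.one_le_ceil_iff.2 (by linarith), ?_, ?_⟩
  · calc L = L ^ (1 - 1 / (q : ℝ)) * R := by rw [hR, ← rpow_add hL0, sub_add_cancel, rpow_one]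
      _ ≤ L ^ (1 - 1 / (q : ℝ)) * ⌈R⌉₊ := by
        gcongr
        exact Nat.le_ceil R
  · calc (⌈R⌉₊ : ℝ) ^ q ≤ (2 * R) ^ q := by gcongr
      _ = 2 ^ q * L := by rw [mul_pow, hRq]

theorem exists_pow_mul_choiceScale_pow_le (a : ℕ) {q : ℕ} (hq : q ≠ 0) {δ : ℝ} (hδ : 0 < δ)
    (hδ1 : δ ≤ 1) :
    ∃ W : ℝ, ∀ x : ℝ, 2 ≤ x → ∃ s : ℕ, 1 ≤ s ∧
      x ^ a * choiceScale q W x ^ s ≤ x ^ s * δ ^ ((2 * s) ^ q) := by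
  obtain ⟨D, hD0, rfl⟩ : ∃ D : ℝ, 0 ≤ D ∧ (2 : ℝ) ^ (-D) = δ :=
    ⟨-logb 2 δ, neg_nonneg.2 (logb_nonpos one_lt_two hδ.le hδ1),
      by rw [neg_neg, rpow_logb two_pos (by norm_num) hδ]⟩
  -- In base-2 logarithms, with `L = log₂ x` and `s ≈ L ^ (1 / q)`, the claim is
  -- `a * L + D * (2 * s) ^ q ≤ W * L ^ (1 - 1 / q) * s`, and both sides are of order `L`.
  refine ⟨a + D * (2 ^ q) ^ 2, fun x hx ↦ ?_⟩
  set W : ℝ := a + D * (2 ^ q) ^ 2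
  have hx0 : 0 < x := by linarith
  obtain ⟨L, hL1, rfl⟩ : ∃ L : ℝ, 1 ≤ L ∧ (2 : ℝ) ^ L = x :=
    ⟨logb 2 x, by rwa [le_logb_iff_rpow_le one_lt_two hx0, rpow_one],
      rpow_logb two_pos (by norm_num) hx0⟩
  obtain ⟨s, hs, hLs, hsL⟩ := exists_nat_le_rpow_mul_and_pow_le hq hL1
  refine ⟨s, hs, ?_⟩
  have hexp : L * a - W * L ^ (1 - 1 / (q : ℝ)) * s ≤ -D * (2 * s) ^ q := by
    have hsmall : D * (2 * s) ^ q ≤ D * (2 ^ q) ^ 2 * L := calc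
      D * (2 * s) ^ q = D * 2 ^ q * (s : ℝ) ^ q := by rw [mul_pow, mul_assoc]
      _ ≤ D * 2 ^ q * (2 ^ q * L) := by gcongr
      _ = D * (2 ^ q) ^ 2 * L := by ring
    have hlarge : W * L ≤ W * (L ^ (1 - 1 / (q : ℝ)) * s) := by gcongr
    linarith
  calc ((2 : ℝ) ^ L) ^ a * choiceScale q W (2 ^ L) ^ s
      = ((2 : ℝ) ^ L) ^ s * 2 ^ (L * a - W * L ^ (1 - 1 / (q : ℝ)) * s) := by
        rw [choiceScale, logb_rpow two_pos (by norm_num), mul_pow, sub_eq_add_neg (L * a),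
          rpow_add two_pos, rpow_mul_natCast two_pos.le, ← neg_mul (W * _),
          rpow_mul_natCast two_pos.le, mul_left_comm]
    _ ≤ ((2 : ℝ) ^ L) ^ s * 2 ^ (-D * (2 * s) ^ q) := by
        gcongr
        exact one_le_two
    _ = ((2 : ℝ) ^ L) ^ s * ((2 : ℝ) ^ (-D)) ^ ((2 * s) ^ q) := by
        rw [← rpow_mul_natCast two_pos.le (-D)]
        push_cast
        rfl

end ChoiceScale

theorem exists_card_cliqueTuples_lt (p : ℕ) {q : ℕ} (hq : q ≠ 0) {δ : ℝ} (hδ : 0 < δ) :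
    ∃ W : ℝ, ∀ {V : Type*} [Fintype V] [DecidableEq V] (G : SimpleGraph V) [DecidableRel G.Adj],
      2 ≤ Fintype.card V → G.CliqueFree (p * q) →
      CliqueIndepNumLT G p (choiceScale q W (Fintype.card V)) →
      (#(cliqueTuples G fun _ : Fin q ↦ univ) : ℝ) < δ * (Fintype.card V : ℝ) ^ q := by
  obtain ⟨W, hW⟩ := exists_pow_mul_choiceScale_pow_le (p * q) hq
    (lt_min hδ one_half_pos) ((min_le_right δ (1 / 2)).trans one_half_lt_one.le)
  refine ⟨W, fun {V} _ _ G _ hV hfree hG ↦ ?_⟩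
  have : Nonempty V := Fintype.card_pos_iff.1 (by omega)
  obtain ⟨s, hs, hpar⟩ := hW (Fintype.card V) (mod_cast hV)
  by_contra! hmany
  have hmany' : min δ (1 / 2) * (Fintype.card V : ℝ) ^ q ≤
      #(cliqueTuples G fun _ : Fin q ↦ univ) := by
    refine le_trans ?_ hmany
    gcongr
    exact min_le_left _ _
  obtain ⟨K, -, hK⟩ := exists_isNClique_mul_of_card_cliqueTuples hs
    (choiceScale_nonneg q W (Nat.cast_nonneg _)) hG q (lt_min hδ one_half_pos)
    (min_le_right _ _) hmany' hpar
  exact hfree K hK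

section EdgeDensity

variable [DecidableRel G.Adj]

theorem edgeDensity_mul_eq_card_interedges (A B : Finset V) :
    (G.edgeDensity A B : ℝ) * (#A * #B) = #(G.interedges A B) := by
  rcases A.eq_empty_or_nonempty with rfl | hA
  · simp [SimpleGraph.interedges_def]
  rcases B.eq_empty_or_nonempty with rfl | hB
  · simp [SimpleGraph.interedges_def]
  rw [SimpleGraph.edgeDensity_def]
  push_cast
  exact div_mul_cancel₀ _ (by positivity)

theorem edgeDensity_mul_eq_sum_card_filter_adj (A B : Finset V) :
    (G.edgeDensity A B : ℝ) * (#A * #B) = ∑ v ∈ A, (#{w ∈ B | G.Adj v w} : ℝ) := by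
  rw [edgeDensity_mul_eq_card_interedges, ← Nat.cast_sum]
  simp only [SimpleGraph.interedges_def, card_filter, sum_product]

theorem mul_card_le_card_filter_of_le_edgeDensity {A B : Finset V} {a b : ℝ} (ha : 0 ≤ a)
    (hab : a + b ≤ G.edgeDensity A B) :
    b * #A ≤ #{v ∈ A | a * #B ≤ #{w ∈ B | G.Adj v w}} := by
  rcases B.eq_empty_or_nonempty with rfl | hB
  · rw [SimpleGraph.edgeDensity_empty_right, Rat.cast_zero] at hab
    exact (mul_nonpos_of_nonpos_of_nonneg (by linarith) (Nat.cast_nonneg _)).trans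
      (Nat.cast_nonneg _)
  have hdeg : ∀ v ∈ A, (#{w ∈ B | G.Adj v w} : ℝ) ≤
      a * #B + if a * #B ≤ #{w ∈ B | G.Adj v w} then (#B : ℝ) else 0 := by
    intro v _
    have : (#{w ∈ B | G.Adj v w} : ℝ) ≤ #B := mod_cast card_filter_le _ _
    split_ifs with h
    · linarith [mul_nonneg ha (Nat.cast_nonneg (α := ℝ) #B)]
    · linarith
  have hsum := sum_le_sum hdeg
  rw [← edgeDensity_mul_eq_sum_card_filter_adj, sum_add_distrib, ← sum_filter, sum_const,
    sum_const, nsmul_eq_mul, nsmul_eq_mul] at hsum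
  refine le_of_mul_le_mul_right ?_ (Nat.cast_pos.2 hB.card_pos : (0 : ℝ) < #B)
  linarith [mul_le_mul_of_nonneg_right hab (by positivity : (0 : ℝ) ≤ #A * #B)]

theorem mul_card_le_card_commonNeighbors {K B : Finset V} {c : ℝ}
    (h : ∀ v ∈ K, (1 - c) * #B ≤ #{w ∈ B | G.Adj v w}) :
    (1 - #K * c) * #B ≤ #{w ∈ B | ∀ v ∈ K, G.Adj v w} := by
  classical
  have hcover : #{w ∈ B | ¬ ∀ v ∈ K, G.Adj v w} ≤ ∑ v ∈ K, #{w ∈ B | ¬ G.Adj v w} := by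
    refine (card_le_card fun w hw ↦ ?_).trans card_biUnion_le
    obtain ⟨hwB, v, hvK, hvw⟩ : w ∈ B ∧ ∃ v ∈ K, ¬ G.Adj v w := by simpa using hw
    exact mem_biUnion.2 ⟨v, hvK, mem_filter.2 ⟨hwB, hvw⟩⟩
  have hmissing : ∀ v ∈ K, (#{w ∈ B | ¬ G.Adj v w} : ℝ) ≤ c * #B := by
    intro v hv
    have : (#{w ∈ B | G.Adj v w} : ℝ) + #{w ∈ B | ¬ G.Adj v w} = #B :=
      mod_cast card_filter_add_card_filter_not (s := B) (G.Adj v)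
    linarith [h v hv]
  have hmissing_sum : (#{w ∈ B | ¬ ∀ v ∈ K, G.Adj v w} : ℝ) ≤ #K * (c * #B) := calc
    (#{w ∈ B | ¬ ∀ v ∈ K, G.Adj v w} : ℝ) ≤ ∑ v ∈ K, (#{w ∈ B | ¬ G.Adj v w} : ℝ) :=
      mod_cast hcover
    _ ≤ ∑ _v ∈ K, c * #B := sum_le_sum hmissing
    _ = #K * (c * #B) := by rw [sum_const, nsmul_eq_mul]
  have hsplit : (#{w ∈ B | ∀ v ∈ K, G.Adj v w} : ℝ) + #{w ∈ B | ¬ ∀ v ∈ K, G.Adj v w} = #B :=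
    mod_cast card_filter_add_card_filter_not (s := B) fun w ↦ ∀ v ∈ K, G.Adj v w
  linarith

theorem exists_isNClique_add_of_le_edgeDensity {a b : ℕ} (ha : 1 ≤ a) {m ε : ℝ} (hε : 0 ≤ ε)
    (hGa : CliqueIndepNumLT G a m) (hGb : CliqueIndepNumLT G b m) {A B : Finset V}
    (hA : m ≤ ε / 2 * #A) (hB : m ≤ ε / 2 * #B)
    (hAB : 1 - 1 / (a : ℝ) + ε ≤ G.edgeDensity A B) : ∃ K, G.IsNClique (a + b) K := by
  classical
  have ha' : (1 : ℝ) ≤ a := mod_cast ha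
  have ha1 : 1 / (a : ℝ) ≤ 1 := div_le_one_of_le₀ ha' (by positivity)
  obtain ⟨K, hKA, hK⟩ := hGa.exists_isNClique <| hA.trans <|
    mul_card_le_card_filter_of_le_edgeDensity (B := B) (a := 1 - 1 / (a : ℝ) + ε / 2)
      (by linarith) ((le_of_eq (by ring)).trans hAB)
  have hcommon := mul_card_le_card_commonNeighbors (G := G) (K := K) (B := B)
    (c := 1 / a - ε / 2) fun v hv ↦
      (le_of_eq (by ring)).trans (mem_filter.1 (hKA hv)).2
  rw [hK.card_eq, mul_sub, mul_one_div_cancel (by positivity), sub_sub_cancel] at hcommon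
  obtain ⟨L, hLN, hL⟩ := hGb.exists_isNClique <| hB.trans <| le_trans
    (by gcongr; exact le_mul_of_one_le_left (by positivity) ha') hcommon
  exact ⟨K ∪ L, isNClique_union hK hL fun u hu v hv ↦ (mem_filter.1 (hLN hv)).2 u hu⟩

end EdgeDensity

theorem two_mul_card_edgeFinset_le_of_cliqueFree [Fintype V] [DecidableRel G.Adj] {r : ℕ}
    (hr : 0 < r) (hG : G.CliqueFree (r + 1)) :
    (2 * #G.edgeFinset : ℝ) ≤ (1 - 1 / (r : ℝ)) * (Fintype.card V : ℝ) ^ 2 := by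
  have hturan : #G.edgeFinset ≤ #(SimpleGraph.turanGraph (Fintype.card V) r).edgeFinset := by
    rw [SimpleGraph.card_edgeFinset_turanGraph]
    exact hG.card_edgeFinset_le
  have hnat : 2 * r * #G.edgeFinset ≤ (r - 1) * Fintype.card V ^ 2 :=
    (Nat.mul_le_mul_left _ hturan).trans SimpleGraph.mul_card_edgeFinset_turanGraph_le
  have hreal : (2 * r * #G.edgeFinset : ℝ) ≤ (r - 1) * (Fintype.card V : ℝ) ^ 2 := by
    rw [← Nat.cast_pred hr]
    exact_mod_cast hnat
  have hr' : (0 : ℝ) < r := mod_cast hr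
  rw [one_sub_div hr'.ne', div_mul_eq_mul_div, le_div_iff₀ hr']
  linarith

section Counting

variable [DecidableRel G.Adj]

/-- `(A, B)` is lower regular with density `d` and threshold `η` if all subsets of `A` and `B` with
at least `η` elements span edge density at least `d`: the one-sided form of regularity used for
counting cliques. The threshold is absolute, so that it is inherited by subsets. -/
def IsLowerRegular (G : SimpleGraph V) [DecidableRel G.Adj] (d η : ℝ) (A B : Finset V) : Prop :=
  ∀ X ⊆ A, ∀ Y ⊆ B, η ≤ #X → η ≤ #Y → d ≤ G.edgeDensity X Y

theorem IsLowerRegular.mono {d η : ℝ} {A A' B B' : Finset V} (h : IsLowerRegular G d η A B)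
    (hA : A' ⊆ A) (hB : B' ⊆ B) : IsLowerRegular G d η A' B' :=
  fun X hX Y hY ↦ h X (hX.trans hA) Y (hY.trans hB)

theorem IsLowerRegular.card_filter_lt_le {d η : ℝ} {A B : Finset V}
    (h : IsLowerRegular G d η A B) (hη : 0 < η) (hB : η ≤ #B) :
    (#{v ∈ A | (#{w ∈ B | G.Adj v w} : ℝ) < d * #B} : ℝ) ≤ η := by
  by_contra! hlt
  set X : Finset V := {v ∈ A | (#{w ∈ B | G.Adj v w} : ℝ) < d * #B}
  have hdens : d ≤ G.edgeDensity X B := h X (filter_subset _ _) B subset_rfl hlt.le hB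
  have hsum : ∑ v ∈ X, (#{w ∈ B | G.Adj v w} : ℝ) < ∑ _v ∈ X, d * #B :=
    sum_lt_sum_of_nonempty (card_pos.1 (Nat.cast_pos.1 (hη.trans hlt)))
      fun v hv ↦ (mem_filter.1 hv).2
  rw [← edgeDensity_mul_eq_sum_card_filter_adj, sum_const, nsmul_eq_mul] at hsum
  linarith [mul_le_mul_of_nonneg_right hdens (by positivity : (0 : ℝ) ≤ #X * #B)]

theorem exists_subset_forall_mul_card_le_card_filter_adj {ι : Type*} [Fintype ι] {d η : ℝ}
    (hη : 0 < η) {A : Finset V} {B : ι → Finset V} (h : ∀ i, IsLowerRegular G d η A (B i))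
    (hB : ∀ i, η ≤ #(B i)) :
    ∃ S ⊆ A, #A - Fintype.card ι * η ≤ #S ∧
      ∀ v ∈ S, ∀ i, d * #(B i) ≤ #{w ∈ B i | G.Adj v w} := by
  classical
  let bad (i : ι) : Finset V := {v ∈ A | (#{w ∈ B i | G.Adj v w} : ℝ) < d * #(B i)}
  have hbad : (#(univ.biUnion bad) : ℝ) ≤ Fintype.card ι * η := calc
    (#(univ.biUnion bad) : ℝ) ≤ ∑ i, (#(bad i) : ℝ) := mod_cast card_biUnion_le
    _ ≤ ∑ _i : ι, η := sum_le_sum fun i _ ↦ (h i).card_filter_lt_le hη (hB i)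
    _ = Fintype.card ι * η := by rw [sum_const, nsmul_eq_mul, card_univ]
  have hcard : (#A : ℝ) ≤ #(A \ univ.biUnion bad) + #(univ.biUnion bad) :=
    mod_cast card_le_card_sdiff_add_card
  refine ⟨A \ univ.biUnion bad, sdiff_subset, by linarith, fun v hv i ↦ ?_⟩
  by_contra! hlt
  obtain ⟨hvA, hvbad⟩ := Finset.mem_sdiff.1 hv
  exact hvbad (mem_biUnion.2 ⟨i, mem_univ i, mem_filter.2 ⟨hvA, hlt⟩⟩)

variable [Fintype V] [DecidableEq V]

theorem card_cliqueTuples_succ {k : ℕ} (A : Fin (k + 1) → Finset V) :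
    #(cliqueTuples G A) =
      ∑ v ∈ A 0, #(cliqueTuples G fun i : Fin k ↦ {w ∈ A i.succ | G.Adj v w}) := by
  rw [← card_filter_cons_mem, ← card_sigma]
  refine card_bij' (fun vx _ ↦ ⟨vx.1, vx.2⟩) (fun vx _ ↦ (vx.1, vx.2)) ?_ ?_ ?_ ?_ <;>
    simp [cons_mem_cliqueTuples]

theorem pow_le_card_cliqueTuples {d η β : ℝ} (hd : 0 < d) (hd1 : d ≤ 1) (hη : 0 < η) {k : ℕ}
    (hβ : k * η ≤ β) {A : Fin k → Finset V} (hcard : ∀ i, 2 * β ≤ #(A i) * d ^ k)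
    (hA : ∀ i j, i ≠ j → IsLowerRegular G d η (A i) (A j)) : β ^ k ≤ #(cliqueTuples G A) := by
  induction k with
  | zero => simp [cliqueTuples]
  | succ k ih =>
    push_cast at hβ
    have hkη : 0 ≤ k * η := by positivity
    have hβ0 : 0 ≤ β := by linarith
    have hsize (i) : 2 * β ≤ #(A i) :=
      (hcard i).trans (mul_le_of_le_one_right (by positivity) (pow_le_one₀ hd.le hd1))
    obtain ⟨good, hgoodA, hgood_card, hgood⟩ := exists_subset_forall_mul_card_le_card_filter_adj hη
      (fun i : Fin k ↦ hA 0 i.succ (Fin.succ_ne_zero i).symm)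
      (fun i ↦ by linarith [hsize i.succ])
    rw [Fintype.card_fin] at hgood_card
    have hβgood : β ≤ #good := by linarith [hsize 0]
    have hlink : ∀ v ∈ good,
        β ^ k ≤ #(cliqueTuples G fun i : Fin k ↦ {w ∈ A i.succ | G.Adj v w}) := by
      refine fun v hv ↦ ih (by linarith) (fun i ↦ ?_) fun i j hij ↦
        (hA i.succ j.succ (by simpa using hij)).mono (filter_subset _ _) (filter_subset _ _)
      calc 2 * β ≤ d * #(A i.succ) * d ^ k := (hcard i.succ).trans_eq (by ring)
        _ ≤ #{w ∈ A i.succ | G.Adj v w} * d ^ k := by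
          gcongr
          exact hgood v hv i
    calc β ^ (k + 1) ≤ #good * β ^ k := by
          rw [pow_succ']
          gcongr
      _ = ∑ _v ∈ good, β ^ k := by rw [sum_const, nsmul_eq_mul]
      _ ≤ ∑ v ∈ good, (#(cliqueTuples G fun i : Fin k ↦ {w ∈ A i.succ | G.Adj v w}) : ℝ) :=
          sum_le_sum hlink
      _ ≤ #(cliqueTuples G A) := by
          rw [card_cliqueTuples_succ, Nat.cast_sum]
          exact sum_le_sum_of_subset_of_nonneg hgoodA fun _ _ _ ↦ by positivity

end Counting

section Regularity

variable [DecidableRel G.Adj]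

/-- The reduced graph of Szemerédi's regularity method, defined on all vertex sets rather than on
the parts of one partition: `U` and `W` are adjacent if `(U, W)` is `ε`-uniform of density at
least `δ`. For a partition `P` of the vertices, `(reducedGraph G ε δ).comap P.part` is the blow-up
of the reduced graph of `P`. -/
def reducedGraph (G : SimpleGraph V) [DecidableRel G.Adj] (ε δ : ℝ) : SimpleGraph (Finset V) where
  Adj U W := U ≠ W ∧ G.IsUniform ε U W ∧ δ ≤ G.edgeDensity U W
  symm.symm U W := by
    rintro ⟨hUW, hunif, hdens⟩
    exact ⟨hUW.symm, hunif.symm, by rwa [SimpleGraph.edgeDensity_comm]⟩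
  loopless.irrefl U h := h.1 rfl

theorem isLowerRegular_of_isUniform {ε d η : ℝ} {U W : Finset V} (h : G.IsUniform ε U W)
    (hd : d + ε ≤ G.edgeDensity U W) (hU : #U * ε ≤ η) (hW : #W * ε ≤ η) :
    IsLowerRegular G d η U W := by
  intro X hX Y hY hXη hYη
  linarith [(abs_lt.1 (h hX hY (hU.trans hXη) (hW.trans hYη))).1]

variable [Fintype V] [DecidableEq V]

theorem pow_le_card_cliqueTuples_of_reducedGraph_adj {k : ℕ} {A : Fin k → Finset V} {ε d l : ℝ}
    (hε : 0 < ε) (hd : 0 < d) (hd1 : d ≤ 1) (hεd : 4 * k * ε ≤ d ^ k) (hl : 0 < l)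
    (hA : ∀ i, l ≤ #(A i) ∧ #(A i) ≤ 2 * l)
    (hadj : ∀ i j, i ≠ j → (reducedGraph G ε (d + ε)).Adj (A i) (A j)) :
    (d ^ k / 2 * l) ^ k ≤ #(cliqueTuples G A) := by
  have hthreshold (i) : #(A i) * ε ≤ 2 * l * ε := by
    gcongr
    exact (hA i).2
  refine pow_le_card_cliqueTuples hd hd1 (η := 2 * l * ε) (by positivity) ?_ (fun i ↦ ?_)
    fun i j hij ↦ isLowerRegular_of_isUniform (hadj i j hij).2.1 (hadj i j hij).2.2
      (hthreshold i) (hthreshold j)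
  · linarith [mul_le_mul_of_nonneg_right hεd hl.le]
  · calc 2 * (d ^ k / 2 * l) = l * d ^ k := by ring
      _ ≤ #(A i) * d ^ k := by
        gcongr
        exact (hA i).1

variable {P : Finpartition (univ : Finset V)}

theorem pow_le_card_cliqueTuples_of_not_cliqueFree_comap_part {k : ℕ} {ε d l : ℝ}
    (hε : 0 < ε) (hd : 0 < d) (hd1 : d ≤ 1) (hεd : 4 * k * ε ≤ d ^ k) (hl : 0 < l)
    (hP : ∀ U ∈ P.parts, l ≤ #U ∧ #U ≤ 2 * l)
    (h : ¬ ((reducedGraph G ε (d + ε)).comap P.part).CliqueFree k) :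
    (d ^ k / 2 * l) ^ k ≤ #(cliqueTuples G fun _ : Fin k ↦ univ) := by
  obtain ⟨φ⟩ := (SimpleGraph.not_cliqueFree_iff_top_isContained _).1 h
  refine (pow_le_card_cliqueTuples_of_reducedGraph_adj (A := fun i ↦ P.part (φ i)) hε hd hd1 hεd hl
    (fun i ↦ hP _ (P.part_mem.2 (mem_univ _))) fun i j hij ↦ φ.toHom.map_adj hij).trans ?_
  exact Nat.cast_le.2 (card_le_card (cliqueTuples_mono fun _ ↦ subset_univ _))

theorem card_filter_adj_and_comap_part_le {κ : ℝ}
    (hκ : ∀ U ∈ P.parts, ∀ W ∈ P.parts, (G.edgeDensity U W : ℝ) ≤ κ)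
    (R : SimpleGraph (Finset V)) [DecidableRel R.Adj] :
    (#{xy : V × V | G.Adj xy.1 xy.2 ∧ R.Adj (P.part xy.1) (P.part xy.2)} : ℝ) ≤
      κ * #{xy : V × V | R.Adj (P.part xy.1) (P.part xy.2)} := by
  let pairs : Finset (Finset V × Finset V) := {UW ∈ P.parts ×ˢ P.parts | R.Adj UW.1 UW.2}
  let toPair (xy : V × V) : Finset V × Finset V := (P.part xy.1, P.part xy.2)
  have hfibers (S : Finset (V × V)) (hS : ∀ xy ∈ S, R.Adj (P.part xy.1) (P.part xy.2)) :
      #S = ∑ UW ∈ pairs, #{xy ∈ S | toPair xy = UW} :=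
    card_eq_sum_card_fiberwise fun xy hxy ↦ mem_filter.2 ⟨mem_product.2
      ⟨P.part_mem.2 (mem_univ _), P.part_mem.2 (mem_univ _)⟩, hS xy hxy⟩
  rw [hfibers _ fun xy hxy ↦ (mem_filter.1 hxy).2.2, hfibers _ fun xy hxy ↦ (mem_filter.1 hxy).2]
  push_cast
  rw [mul_sum]
  refine sum_le_sum fun ⟨U, W⟩ hUW ↦ ?_
  obtain ⟨hparts, hadj⟩ := mem_filter.1 hUW
  obtain ⟨hU, hW⟩ := mem_product.1 hparts
  have hedges : ({xy ∈ {xy : V × V | G.Adj xy.1 xy.2 ∧ R.Adj (P.part xy.1) (P.part xy.2)} |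
      toPair xy = (U, W)} : Finset (V × V)) = G.interedges U W := by
    ext ⟨x, y⟩
    simp only [mem_filter, mem_univ, true_and, SimpleGraph.mk_mem_interedges_iff, toPair,
      Prod.mk_inj, ← P.part_eq_iff_mem hU, ← P.part_eq_iff_mem hW]
    grind
  have hpairs : ({xy ∈ {xy : V × V | R.Adj (P.part xy.1) (P.part xy.2)} |
      toPair xy = (U, W)} : Finset (V × V)) = U ×ˢ W := by
    ext ⟨x, y⟩
    simp only [mem_filter, mem_univ, true_and, mem_product, toPair, Prod.mk_inj,
      ← P.part_eq_iff_mem hU, ← P.part_eq_iff_mem hW]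
    grind
  rw [hedges, hpairs, card_product, ← edgeDensity_mul_eq_card_interedges, Nat.cast_mul]
  exact mul_le_mul_of_nonneg_right (hκ U hU W hW) (by positivity)

theorem card_filter_adj_and_not_comap_part_le [Nonempty V] {ε ε' δ : ℝ} (hP : P.IsEquipartition)
    (hε : 0 < ε) (hPε : P.IsUniform G ε) (hε' : 0 < ε') (hPε' : 4 / ε' ≤ #P.parts) (hδ : 0 ≤ δ)
    [DecidableRel (reducedGraph G ε δ).Adj] :
    (#{xy : V × V | G.Adj xy.1 xy.2 ∧
      ¬ (reducedGraph G ε δ).Adj (P.part xy.1) (P.part xy.2)} : ℝ) ≤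
      (4 * ε + ε' / 2 + 4 * δ) * (Fintype.card V : ℝ) ^ 2 := by
  let irregular := (P.nonUniforms G ε).biUnion fun UW ↦ UW.1 ×ˢ UW.2
  let inner := P.parts.biUnion offDiag
  let sparse := (P.sparsePairs G δ).biUnion fun UW ↦ G.interedges UW.1 UW.2
  have hcover : ({xy : V × V | G.Adj xy.1 xy.2 ∧
      ¬ (reducedGraph G ε δ).Adj (P.part xy.1) (P.part xy.2)} : Finset (V × V)) ⊆
      irregular ∪ inner ∪ sparse := by
    rintro ⟨x, y⟩ hxy
    obtain ⟨hadj, hR⟩ := (mem_filter.1 hxy).2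
    have hpart (z : V) : P.part z ∈ P.parts := P.part_mem.2 (mem_univ z)
    have hmem (z : V) : z ∈ P.part z := P.mem_part (mem_univ z)
    simp only [mem_union, irregular, inner, sparse, mem_biUnion, Prod.exists,
      Finpartition.mk_mem_nonUniforms, Finpartition.mk_mem_sparsePairs, mem_offDiag, mem_product,
      SimpleGraph.mk_mem_interedges_iff]
    by_cases hne : P.part x = P.part y
    · exact .inl (.inr ⟨P.part x, hpart x, hmem x, hne ▸ hmem y, hadj.ne⟩)
    by_cases hunif : G.IsUniform ε (P.part x) (P.part y)
    · have hdens : (G.edgeDensity (P.part x) (P.part y) : ℝ) < δ := by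
        by_contra! h
        exact hR ⟨hne, hunif, h⟩
      exact .inr ⟨_, _, ⟨hpart x, hpart y, hne, hdens⟩, hmem x, hmem y, hadj⟩
    · exact .inl (.inl ⟨_, _, ⟨hpart x, hpart y, hne, hunif⟩, hmem x, hmem y⟩)
  have hirregular : (#irregular : ℝ) ≤ 4 * ε * (Fintype.card V : ℝ) ^ 2 :=
    (hP.sum_nonUniforms_lt univ_nonempty hε hPε).le
  have hinner : (#inner : ℝ) ≤ ε' / 2 * (Fintype.card V : ℝ) ^ 2 :=
    hP.card_biUnion_offDiag_le hε' hPε'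
  have hsparse : (#sparse : ℝ) ≤ 4 * δ * (Fintype.card V : ℝ) ^ 2 :=
    hP.card_interedges_sparsePairs_le hδ
  have hunion : #(irregular ∪ inner ∪ sparse) ≤ #irregular + #inner + #sparse :=
    (card_union_le _ _).trans (Nat.add_le_add_right (card_union_le _ _) _)
  calc _ ≤ (#irregular + #inner + #sparse : ℝ) := mod_cast (card_le_card hcover).trans hunion
    _ ≤ _ := by linarith

theorem two_mul_card_edgeFinset_le_add_mul_card_edgeFinset_comap_part [Nonempty V] {ε ε' δ κ : ℝ}
    (hP : P.IsEquipartition) (hε : 0 < ε) (hPε : P.IsUniform G ε) (hε' : 0 < ε')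
    (hPε' : 4 / ε' ≤ #P.parts) (hδ : 0 ≤ δ)
    (hκ : ∀ U ∈ P.parts, ∀ W ∈ P.parts, (G.edgeDensity U W : ℝ) ≤ κ)
    [DecidableRel (reducedGraph G ε δ).Adj] :
    (2 * #G.edgeFinset : ℝ) ≤ (4 * ε + ε' / 2 + 4 * δ) * (Fintype.card V : ℝ) ^ 2 +
      κ * (2 * #((reducedGraph G ε δ).comap P.part).edgeFinset) := by
  have hcard (H : SimpleGraph V) [DecidableRel H.Adj] :
      (2 * #H.edgeFinset : ℝ) = #{xy : V × V | H.Adj xy.1 xy.2} :=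
    mod_cast H.two_mul_card_edgeFinset
  have hsplit := card_filter_add_card_filter_not (s := ({xy : V × V | G.Adj xy.1 xy.2} : Finset _))
    fun xy ↦ (reducedGraph G ε δ).Adj (P.part xy.1) (P.part xy.2)
  rw [filter_filter, filter_filter] at hsplit
  rw [hcard, hcard, ← hsplit]
  push_cast
  simp only [SimpleGraph.comap_adj]
  linarith [card_filter_adj_and_comap_part_le hκ (reducedGraph G ε δ),
    card_filter_adj_and_not_comap_part_le hP hε hPε hε' hPε' hδ]

theorem two_mul_card_edgeFinset_le_of_cliqueFree_comap_part [Nonempty V] {ε ε' δ κ : ℝ} {r : ℕ}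
    (hr : 0 < r) (hP : P.IsEquipartition) (hε : 0 < ε) (hPε : P.IsUniform G ε) (hε' : 0 < ε')
    (hPε' : 4 / ε' ≤ #P.parts) (hδ : 0 ≤ δ) (hκ0 : 0 ≤ κ)
    (hκ : ∀ U ∈ P.parts, ∀ W ∈ P.parts, (G.edgeDensity U W : ℝ) ≤ κ)
    (hfree : ((reducedGraph G ε δ).comap P.part).CliqueFree (r + 1)) :
    (2 * #G.edgeFinset : ℝ) ≤
      (κ * (1 - 1 / (r : ℝ)) + (4 * ε + ε' / 2 + 4 * δ)) * (Fintype.card V : ℝ) ^ 2 := by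
  classical
  have hreduced := two_mul_card_edgeFinset_le_add_mul_card_edgeFinset_comap_part hP hε hPε hε'
    hPε' hδ hκ
  have hturan := mul_le_mul_of_nonneg_left (two_mul_card_edgeFinset_le_of_cliqueFree hr hfree) hκ0
  linarith

end Regularity

theorem card_part_le_two_mul_average [DecidableEq V] {s : Finset V} {P : Finpartition s}
    (hP : P.IsEquipartition) {U : Finset V} (hU : U ∈ P.parts) : #U ≤ 2 * (#s / #P.parts) := by
  have haverage : 1 ≤ #s / #P.parts :=
    (Nat.one_le_div_iff (card_pos.2 ⟨U, hU⟩)).2 P.card_parts_le_card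
  have := hP.card_part_le_average_add_one hU
  omega

theorem div_two_mul_le_natDiv {n k K : ℕ} (hk : 0 < k) (hkn : k ≤ n) (hkK : k ≤ K) :
    (n : ℝ) / (2 * K) ≤ (n / k : ℕ) := by
  have hdiv : 1 ≤ n / k := (Nat.one_le_div_iff hk).2 hkn
  have hK : (0 : ℝ) < K := mod_cast hk.trans_le hkK
  rw [div_le_iff₀ (by positivity)]
  have : n ≤ n / k * (2 * K) := calc
    n ≤ n / k * k + k := (Nat.lt_div_mul_add hk).le
    _ ≤ n / k * K + n / k * K := by
      gcongr
      exact hkK.trans (Nat.le_mul_of_pos_left K hdiv)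
    _ = n / k * (2 * K) := by ring
  exact_mod_cast this

theorem exists_regularity_parameters {k : ℕ} (hk : 2 ≤ k) {ε : ℝ} (hε : 0 < ε) :
    ∃ d η : ℝ, 0 < d ∧ d ≤ 1 ∧ 0 < η ∧ 4 * k * η ≤ d ^ k ∧ 4 * η + ε / 2 + 4 * (d + η) ≤ ε := by
  let d : ℝ := min (ε / 16) 1
  have hd : 0 < d := by positivity
  have hd1 : d ≤ 1 := min_le_right _ _
  have hdε : d ≤ ε / 16 := min_le_left _ _
  have hk' : (2 : ℝ) ≤ k := mod_cast hk
  refine ⟨d, d ^ k / (4 * k), hd, hd1, by positivity, (mul_div_cancel₀ _ (by positivity)).le, ?_⟩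
  have hη : d ^ k / (4 * k) ≤ d / 8 := by
    gcongr
    · exact pow_le_of_le_one hd.le hd1 (by omega)
    · linarith
  linarith

theorem exists_two_mul_card_edgeFinset_le_of_card_cliqueTuples_lt {r : ℕ} (hr : 0 < r) {ε : ℝ}
    (hε : 0 < ε) :
    ∃ δ > (0 : ℝ), ∃ γ > (0 : ℝ), ∃ N : ℕ, ∀ {V : Type*} [Fintype V] [DecidableEq V]
      (G : SimpleGraph V) [DecidableRel G.Adj] (κ : ℝ), N ≤ Fintype.card V → 0 ≤ κ →
      (#(cliqueTuples G fun _ : Fin (r + 1) ↦ univ) : ℝ) < δ * (Fintype.card V : ℝ) ^ (r + 1) →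
      (∀ A B : Finset V, γ * Fintype.card V ≤ #A → γ * Fintype.card V ≤ #B →
        (G.edgeDensity A B : ℝ) ≤ κ) →
      (2 * #G.edgeFinset : ℝ) ≤ (κ * (1 - 1 / (r : ℝ)) + ε) * (Fintype.card V : ℝ) ^ 2 := by
  obtain ⟨d, η, hd, hd1, hη, hηd, hsum⟩ := exists_regularity_parameters (Nat.succ_le_succ hr) hε
  let l : ℕ := ⌈4 / ε⌉₊
  have hl : 0 < l := Nat.ceil_pos.2 (by positivity)
  let K : ℕ := SzemerediRegularity.bound η l
  refine ⟨(d ^ (r + 1) / 2 * (1 / (2 * K))) ^ (r + 1), by positivity, 1 / (2 * K), by positivity, l,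
    fun {V} _ _ G _ κ hV hκ hfew hdens ↦ ?_⟩
  have : Nonempty V := Fintype.card_pos_iff.1 (hl.trans_le hV)
  obtain ⟨P, hP, hlP, hPK, hunif⟩ := szemeredi_regularity G hη hV
  have hPpos : 0 < #P.parts := hl.trans_le hlP
  have haverage : 1 / (2 * K : ℝ) * Fintype.card V ≤ (Fintype.card V / #P.parts : ℕ) := by
    rw [one_div_mul_eq_div]
    exact div_two_mul_le_natDiv hPpos P.card_parts_le_card hPK
  have hparts (U) (hU : U ∈ P.parts) : ((Fintype.card V / #P.parts : ℕ) : ℝ) ≤ #U ∧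
      (#U : ℝ) ≤ 2 * (Fintype.card V / #P.parts : ℕ) :=
    ⟨mod_cast hP.average_le_card_part hU, mod_cast card_part_le_two_mul_average hP hU⟩
  have hfree : ((reducedGraph G η (d + η)).comap P.part).CliqueFree (r + 1) := by
    by_contra hclique
    have hmany := pow_le_card_cliqueTuples_of_not_cliqueFree_comap_part hη hd hd1 hηd
      (Nat.cast_pos.2 (Nat.div_pos P.card_parts_le_card hPpos)) hparts hclique
    refine hfew.not_ge (le_trans ?_ hmany)
    rw [← mul_pow, mul_assoc]
    gcongr
    exact haverage
  refine (two_mul_card_edgeFinset_le_of_cliqueFree_comap_part hr hP hη hunif hε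
    ((Nat.le_ceil _).trans (Nat.cast_le.2 hlP)) (by positivity) hκ (fun U hU W hW ↦ hdens U W
      (haverage.trans (hparts U hU).1) (haverage.trans (hparts W hW).1)) hfree).trans ?_
  gcongr

theorem exists_two_mul_card_edgeFinset_le {p q t : ℕ} (hq : 2 ≤ q) (ht : 1 ≤ t)
    (hpq : 2 * t ≤ p * q) {ε : ℝ} (hε : 0 < ε) :
    ∃ c > (0 : ℝ), ∃ W : ℝ, ∃ N : ℕ, ∀ {V : Type*} [Fintype V] [DecidableEq V] (G : SimpleGraph V)
      [DecidableRel G.Adj], N ≤ Fintype.card V → G.CliqueFree (2 * t) →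
      CliqueIndepNumLT G t (c * Fintype.card V) →
      CliqueIndepNumLT G p (choiceScale q W (Fintype.card V)) →
      (2 * #G.edgeFinset : ℝ) ≤
        ((1 - 1 / (t : ℝ)) * (1 - 1 / ((q : ℝ) - 1)) + ε) * (Fintype.card V : ℝ) ^ 2 := by
  obtain ⟨r, rfl⟩ : ∃ r, q = r + 1 := ⟨q - 1, by omega⟩
  have hr : 0 < r := by omega
  have hε' : 0 < ε / 2 := half_pos hε
  obtain ⟨δ, hδ, γ, hγ, N, hN⟩ := exists_two_mul_card_edgeFinset_le_of_card_cliqueTuples_lt hr hε'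
  obtain ⟨W, hW⟩ := exists_card_cliqueTuples_lt p r.succ_ne_zero hδ
  refine ⟨ε / 2 / 2 * γ, by positivity, W, max N 2, fun {V} _ _ G _ hV hfree hGt hGp ↦ ?_⟩
  have ht1 : 1 / (t : ℝ) ≤ 1 := div_le_one_of_le₀ (mod_cast ht) (by positivity)
  have hr1 : 0 ≤ 1 / (r : ℝ) := by positivity
  have hfew := hW G ((le_max_right N 2).trans hV) (hfree.mono hpq) hGp
  have hdens (A B : Finset V) (hA : γ * Fintype.card V ≤ #A) (hB : γ * Fintype.card V ≤ #B) :
      (G.edgeDensity A B : ℝ) ≤ 1 - 1 / (t : ℝ) + ε / 2 := by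
    by_contra! hlt
    obtain ⟨K, hK⟩ := exists_isNClique_add_of_le_edgeDensity ht hε'.le hGt hGt
      (by rw [mul_assoc]; gcongr) (by rw [mul_assoc]; gcongr) hlt.le
    exact hfree K (two_mul t ▸ hK)
  refine (hN G _ ((le_max_left N 2).trans hV) (by linarith) hfew hdens).trans ?_
  refine mul_le_mul_of_nonneg_right ?_ (sq_nonneg _)
  push_cast
  rw [add_sub_cancel_right]
  linarith [mul_nonneg hε'.le hr1]

theorem ramseyTuran_le {W : Type*} {n : ℕ} {H : SimpleGraph W} {m c : ℝ} (hc : 0 ≤ c)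
    (h : ∀ G : SimpleGraph (Fin n), H.Free G → (G.indepNum : ℝ) < m → (G.edgeSet.ncard : ℝ) ≤ c) :
    (ramseyTuran n H m : ℝ) ≤ c := by
  have hfloor : ramseyTuran n H m ≤ ⌊c⌋₊ := by
    refine csSup_le' ?_
    rintro _ ⟨G, hG, hind, rfl⟩
    exact Nat.le_floor (h G hG hind)
  exact (Nat.cast_le.2 hfloor).trans (Nat.floor_le hc)

theorem eventually_ramseyTuran_le {p q t : ℕ} (hq : 2 ≤ q) (ht : 1 ≤ t) (hpq : 2 * t ≤ p * q)
    {ω g m : ℕ → ℝ} (hω : Tendsto ω atTop atTop) (hg : g =o[atTop] fun n ↦ (n : ℝ))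
    (hmt : ∀ᶠ n in atTop, m n ≤ ramseyQ t ⌊g n⌋₊)
    (hmp : ∀ᶠ n : ℕ in atTop, m n ≤ ramseyQ p ⌊choiceScale q (ω n) n⌋₊) {ε : ℝ} (hε : 0 < ε) :
    ∀ᶠ n : ℕ in atTop, (ramseyTuran n (SimpleGraph.completeGraph (Fin (2 * t))) (m n) : ℝ) ≤
      (1 / 2 * (1 - 1 / (t : ℝ)) * (1 - 1 / ((q : ℝ) - 1)) + ε) * (n : ℝ) ^ 2 := by
  classical
  have hτ : 0 ≤ 1 - 1 / (t : ℝ) := Nat.one_sub_one_div_cast_nonneg t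
  have hσ : 0 ≤ 1 - 1 / ((q : ℝ) - 1) := by
    rw [← Nat.cast_pred (by omega)]
    exact Nat.one_sub_one_div_cast_nonneg _
  obtain ⟨c, hc, W, N, hN⟩ := exists_two_mul_card_edgeFinset_le hq ht hpq (mul_pos two_pos hε)
  filter_upwards [hmt, hmp, hg.bound hc, hω.eventually_ge_atTop W, eventually_ge_atTop N,
    eventually_ge_atTop 1] with n hmtn hmpn hgn hWn hNn hn1
  have hn : (1 : ℝ) ≤ n := mod_cast hn1
  refine ramseyTuran_le (by positivity) fun G hG hind ↦ ?_
  have hfree : G.CliqueFree (2 * t) := by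
    by_contra h
    exact hG ((SimpleGraph.not_cliqueFree_iff_top_isContained _).1 h)
  have hGt := cliqueIndepNumLT_of_indepNum_lt_ramseyQ (mod_cast hind.trans_le hmtn)
  have hGp := cliqueIndepNumLT_of_indepNum_lt_ramseyQ (mod_cast hind.trans_le hmpn)
  have hedges := hN G (by rwa [Fintype.card_fin]) hfree
    (hGt.mono (by simpa using (le_abs_self _).trans hgn))
    (hGp.mono (by simpa using choiceScale_le_choiceScale q hWn hn))
  rw [Fintype.card_fin] at hedges
  rw [← SimpleGraph.coe_edgeFinset, Set.ncard_coe_finset]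
  linarith

theorem natCast_div_isLittleO {ω : ℕ → ℝ} (hω : Tendsto ω atTop atTop) :
    (fun n : ℕ ↦ (n : ℝ) / ω n) =o[atTop] fun n ↦ (n : ℝ) := by
  simpa [div_eq_mul_inv] using
    (Asymptotics.isBigO_refl (fun n : ℕ ↦ (n : ℝ)) atTop).mul_isLittleO
      ((Asymptotics.isLittleO_one_iff ℝ).2 hω.inv_tendsto_atTop)

end RamseyTuran

open RamseyTuran in
theorem mainTheorem5_general {p q t : ℕ} (_hp : 2 ≤ p) (hq : 2 ≤ q) (ht : 2 ≤ t)
    (hpq : 2 * t ≤ p * q) {ω g m : ℕ → ℝ} (hω : Tendsto ω atTop atTop)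
    (hg : g =o[atTop] fun n ↦ (n : ℝ)) (hmt : ∀ᶠ n in atTop, m n ≤ ramseyQ t ⌊g n⌋₊)
    (hmp : ∀ᶠ n : ℕ in atTop, m n ≤ ramseyQ p ⌊choiceScale q (ω n) n⌋₊) :
    upperRamseyTuranDensity (SimpleGraph.completeGraph (Fin (2 * t))) m ≤
      1 / 2 * (1 - 1 / (t : ℝ)) * (1 - 1 / ((q : ℝ) - 1)) := by
  refine le_of_forall_pos_le_add fun ε hε ↦ ?_
  refine limsup_le_of_le (isCoboundedUnder_le_of_le atTop (x := 0) fun _ ↦ by positivity) ?_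
  filter_upwards [eventually_ramseyTuran_le hq (by omega) hpq hω hg hmt hmp hε,
    eventually_ge_atTop 1] with n hn hn1
  rwa [div_le_iff₀ (by positivity)]

theorem mainTheorem5 (p q t : ℕ) (hp : 2 ≤ p) (hq : 2 ≤ q) (ht : 2 ≤ t)
    (ω : ℕ → ℝ) (hω : Tendsto ω atTop atTop)
    (f : ℕ → ℝ)
    (hf : ∀ n : ℕ, f n =
      (n : ℝ) * (2 : ℝ) ^ (-(ω n * Real.logb 2 (n : ℝ) ^ (1 - 1 / (q : ℝ)))))
    (hpq : 2 * t ≤ p * q)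
    (hQ : ∀ᶠ n : ℕ in atTop, ramseyQ t ⌊(n : ℝ) / ω n⌋₊ ≤ ramseyQ p ⌊f n⌋₊) :
    upperRamseyTuranDensity (SimpleGraph.completeGraph (Fin (2 * t)))
        (fun n : ℕ => (ramseyQ t ⌊(n : ℝ) / ω n⌋₊ : ℝ))
      ≤ 1 / 2 * (1 - 1 / (t : ℝ)) * (1 - 1 / ((q : ℝ) - 1)) := by
  obtain rfl : f = fun n ↦ RamseyTuran.choiceScale q (ω n) n := funext hf
  exact mainTheorem5_general hp hq ht hpq hω (RamseyTuran.natCast_div_isLittleO hω)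
    (.of_forall fun _ ↦ le_rfl) (hQ.mono fun _ ↦ Nat.cast_le.2)
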